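/- Let $(\Omega,\mathcal F,\mathbb P)$ be a probability space carrying an $m$-dimensional Brownian motion $B$ and, independent of $B$, a Lévy process $L$ with values in $\mathbb R^d$ ($L(0)=0$ a.s., independent and stationary increments, stochastically continuous) with Lévy triplet $(0,0,\nu)$, i.e. $\nu$ is a Lévy measure on $\mathbb R^d\setminus\{0\}$ and $$\mathbb E\,e^{iu\cdot L(t)}=\exp\Big(t\int_{\mathbb R^d\setminus\{0\}}\big(e^{iu\cdot z}-1-iu\cdot z\,1_{\{|z|<1\}}\big)\,\nu(dz)\Big),\qquad t\ge 0,\ u\in\mathbb R^d.$$ Assume that $\int_{|z|<1}|z|^{\gamma_0}\nu(dz)<\infty$ for some $\gamma_0\in[1,2]$, that $\int_{|z|\ge1}|z|^{\gamma_\infty}\nu(dz)<\infty$ for some $\gamma_\infty>1$, and that $L(t)$ is integrable with $\mathbb E\,L(t)=0$ for all $t\ge 0$. Let $f:\mathbb R^d\to\mathbb R^d$ be continuous, let $g:\mathbb R^d\to\mathbb R^{d\times m}$, and suppose that there are constants $K_3<-\tfrac12$ and $K_4>0$ with $K_4+2K_3<-1$ such that for all $x,y\in\mathbb R^d$ $$(x-y)^{\mathrm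 T}\big(f(x)-f(y)\big)\le K_3|x-y|^2,\qquad |g(x)-g(y)|^2\le K_4|x-y|^2,$$ where $|\cdot|$ is the Euclidean norm (for matrices, the Frobenius norm). Then for every fixed $\Delta t\in(0,1)$ the following holds. For each $x\in\mathbb R^d$ there is an almost surely unique sequence of random variables $(X_i^x)_{i\ge0}$ (the semi-implicit Euler–Maruyama chain started at $x$) with $X_0^x=x$ and $$X_{i+1}^x=X_i^x+f(X_{i+1}^x)\,\Delta t+g(X_i^x)\big(B((i+1)\Delta t)-B(i\Delta t)\big)+L((i+1)\Delta t)-L(i\Delta t),\qquad i\ge 0,$$ almost surely, and this chain has a unique invariant measure: with $\mathbb P_i(x,S)=\mathbb P(X_i^x\in S)$, there is exactly one Borel probability measure $\Pi_{\Delta t}$ on $\mathbb R^d$ such that $$\Pi_{\Delta t}(S)=\int_{\mathbb R^d}\mathbb P_i(x,S)\,\Pi_{\Delta t}(dx)\qquad\text{for all } i\ge 0 \text{ and all Borel sets } S\subseteq\mathbb R^d .$$ -/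

import Mathlib

open MeasureTheory ProbabilityTheory Filter Topology
open scoped NNReal ENNReal

/-- An `m`-dimensional Brownian motion: the coordinates are independent one-dimensional
(standard) Brownian motions. -/
structure IsBrownianVector {Ω : Type*} [MeasurableSpace Ω] (P : Measure Ω) {m : ℕ}
    (B : ℝ≥0 → Ω → EuclideanSpace ℝ (Fin m)) : Prop where
  measurable : ∀ t, Measurable (B t)
  brownian : ∀ j : Fin m, IsBrownianReal (fun t ω => B t ω j) P
  indep : iIndepFun (fun (j : Fin m) (ω : Ω) (t : ℝ≥0) => B t ω j) P

/-- A Lévy process: it starts at `0`, has independent and stationary increments and is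
stochastically continuous. -/
structure IsLevyProcess {Ω : Type*} [MeasurableSpace Ω] (P : Measure Ω) {d : ℕ}
    (L : ℝ≥0 → Ω → EuclideanSpace ℝ (Fin d)) : Prop where
  measurable : ∀ t, Measurable (L t)
  zero : ∀ᵐ ω ∂P, L 0 ω = 0
  indep_increments : HasIndepIncrements L P
  stationary_increments :
    ∀ s t : ℝ≥0, IdentDistrib (fun ω => L (s + t) ω - L s ω) (L t) P P
  stochastically_continuous : ∀ s : ℝ≥0, TendstoInMeasure P L (𝓝 s) (L s)

/-- A Lévy measure on `ℝ^d`, seen as a measure on `ℝ^d` without mass at the origin. -/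
structure IsLevyMeasure {d : ℕ} (ν : Measure (EuclideanSpace ℝ (Fin d))) : Prop where
  zero : ν {0} = 0
  lintegral_lt_top : ∫⁻ z, ENNReal.ofReal (min 1 (‖z‖ ^ 2)) ∂ν < ∞

/-- The Lévy exponent of the triplet `(0, 0, ν)` (truncation function `1_{|z| < 1}`):
`∫ (e^{i⟨z,u⟩} - 1 - i ⟨z,u⟩ 1_{|z| < 1}) ν(dz)`. -/
noncomputable def levyExponent {d : ℕ} (ν : Measure (EuclideanSpace ℝ (Fin d)))
    (u : EuclideanSpace ℝ (Fin d)) : ℂ :=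
  ∫ z, (Complex.exp ((inner ℝ z u : ℝ) * Complex.I) - 1
    - ({z : EuclideanSpace ℝ (Fin d) | ‖z‖ < 1}.indicator
        (fun z => ((inner ℝ z u : ℝ) : ℂ) * Complex.I) z)) ∂ν

/-- The process `L` has Lévy triplet `(0, 0, ν)`: its characteristic function is given by the
Lévy–Khintchine formula for this triplet. -/
def HasPureJumpTriplet {Ω : Type*} [MeasurableSpace Ω] (P : Measure Ω) {d : ℕ}
    (L : ℝ≥0 → Ω → EuclideanSpace ℝ (Fin d))
    (ν : Measure (EuclideanSpace ℝ (Fin d))) : Prop :=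
  IsLevyMeasure ν ∧ ∀ (t : ℝ≥0) (u : EuclideanSpace ℝ (Fin d)),
    charFun (P.map (L t)) u = Complex.exp (((t : ℝ) : ℂ) * levyExponent ν u)

/-- The sequence `X` of random variables is a numerical solution, started at the point `x`, of
the semi-implicit Euler–Maruyama method with step `Δt`:
almost surely `X₀ = x` and, with `t_i = i Δt`,
`X_{i+1} = X_i + f(X_{i+1}) Δt + g(X_i) (B(t_{i+1}) - B(t_i)) + (L(t_{i+1}) - L(t_i))`. -/
def IsSemiImplicitEM {Ω : Type*} [MeasurableSpace Ω] (P : Measure Ω) {d m : ℕ}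
    (f : EuclideanSpace ℝ (Fin d) → EuclideanSpace ℝ (Fin d))
    (g : EuclideanSpace ℝ (Fin d) → Matrix (Fin d) (Fin m) ℝ)
    (B : ℝ≥0 → Ω → EuclideanSpace ℝ (Fin m)) (L : ℝ≥0 → Ω → EuclideanSpace ℝ (Fin d))
    (Δt : ℝ≥0) (x : EuclideanSpace ℝ (Fin d)) (X : ℕ → Ω → EuclideanSpace ℝ (Fin d)) : Prop :=
  (∀ i, Measurable (X i)) ∧
  ∀ᵐ ω ∂P, X 0 ω = x ∧ ∀ i : ℕ,
    X (i + 1) ω = X i ω + (Δt : ℝ) • f (X (i + 1) ω)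
      + (g (X i ω)).toEuclideanLin (B (((i + 1 : ℕ) : ℝ≥0) * Δt) ω - B ((i : ℝ≥0) * Δt) ω)
      + (L (((i + 1 : ℕ) : ℝ≥0) * Δt) ω - L ((i : ℝ≥0) * Δt) ω)

/-- The `i`-step transition probability `ℙ_i(x, S) = ℙ(X_i^x ∈ S)` of the family of chains
`X^x`, where `x` is the starting point. -/
def transitionProb {Ω : Type*} [MeasurableSpace Ω] (P : Measure Ω) {d : ℕ}
    (X : EuclideanSpace ℝ (Fin d) → ℕ → Ω → EuclideanSpace ℝ (Fin d))
    (i : ℕ) (x : EuclideanSpace ℝ (Fin d)) (S : Set (EuclideanSpace ℝ (Fin d))) : ℝ≥0∞ :=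
  P {ω | X x i ω ∈ S}

/-- The probability measure `π` is invariant for the family of chains `X^x`:
`π(S) = ∫ ℙ_i(x, S) π(dx)` for every `i` and every Borel set `S`. -/
def IsInvariantMeasure {Ω : Type*} [MeasurableSpace Ω] (P : Measure Ω) {d : ℕ}
    (X : EuclideanSpace ℝ (Fin d) → ℕ → Ω → EuclideanSpace ℝ (Fin d))
    (π : Measure (EuclideanSpace ℝ (Fin d))) : Prop :=
  IsProbabilityMeasure π ∧ ∀ (i : ℕ) (S : Set (EuclideanSpace ℝ (Fin d))), MeasurableSet S →
    π S = ∫⁻ x, transitionProb P X i x S ∂π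

/-! Write δ for the step. Since `K₃ < 0`, the map `x ↦ x - δ f(x)` is continuous and strongly
monotone, hence bijective by Minty–Browder, and its inverse `F` is Lipschitz with constant `(1 -
2K₃δ)^(-1/2)`. The scheme is therefore the explicit recursion `X_{i+1} = F(X_i + g(X_i) ΔB_i +
ΔL_i)`, a random map driven by i.i.d. noise. This gives existence and uniqueness of the chain, and
its transition probabilities are the powers of a Markov kernel.

Run two copies from `x` and `y` with the same noise. The Lévy increments cancel, and the Gaussian
second moment of `(x - y) + (g(x) - g(y)) ΔB` is at most `(1 + K₄δ)|x - y|²`. By Cauchy–Schwarz one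
step contracts the mean distance by `r = √((1 + K₄δ)/(1 - 2K₃δ))`, and `r < 1` because `K₄ + 2K₃ <
0`. First moments are used because `L` is only assumed integrable.

Hence the transition operator multiplies Lipschitz constants by `r`, and its iterates on a bounded
Lipschitz function become asymptotically constant. So two invariant laws integrate every such
function to the same value (`ContractsLipschitz.eq_of_comp_eq`). Comparison with the start `0`
bounds the first moments of the chain, which gives tightness; by Prokhorov its laws have a cluster
point, and the contraction makes that point invariant (`ContractsLipschitz.exists_comp_eq`). -/

/-! ### Monotone operators and the Minty–Browder theorem -/

section Monotone

variable {E : Type*} [NormedAddCommGroup E] [InnerProductSpace ℝ E]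

/-- Finite form of the Debrunner–Flor lemma: a monotone map admits a solution of finitely many
Minty inequalities in the convex hull of the test points. -/
lemma exists_mem_stdSimplex_forall_inner_nonneg {ι : Type*} [Fintype ι] [Nonempty ι]
    {G : E → E} (hG : ∀ x y, 0 ≤ inner ℝ (x - y) (G x - G y)) (p : ι → E) :
    ∃ a ∈ stdSimplex ℝ ι, ∀ i, 0 ≤ inner ℝ (p i - ∑ j, a j • p j) (G (p i)) := by
  classical
  -- This function is affine in each variable on a compact simplex, so Sion's theorem yields a
  -- saddle point. Testing it against vertices recovers the individual inequalities.
  let F : (ι → ℝ) → (ι → ℝ) → ℝ :=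
    fun a b => ∑ i, b i * inner ℝ ((∑ j, a j • p j) - p i) (G (p i))
  have hne : (stdSimplex ℝ ι).Nonempty :=
    ⟨_, single_mem_stdSimplex ℝ (Classical.arbitrary ι)⟩
  have hcv : Convex ℝ (stdSimplex ℝ ι) := convex_stdSimplex ℝ ι
  have hcx : ∀ b ∈ stdSimplex ℝ ι, ConvexOn ℝ (stdSimplex ℝ ι) (fun a => F a b) := by
    intro b _
    refine ⟨hcv, fun x _ y _ s t _ _ hst => le_of_eq ?_⟩
    simp only [F, smul_eq_mul, Finset.mul_sum, ← Finset.sum_add_distrib, Pi.add_apply,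
      Pi.smul_apply]
    refine Finset.sum_congr rfl fun i _ => ?_
    have : (∑ j, (s * x j + t * y j) • p j) - p i
        = s • ((∑ j, x j • p j) - p i) + t • ((∑ j, y j • p j) - p i) := by
      simp only [add_smul, mul_smul, Finset.sum_add_distrib, ← Finset.smul_sum, smul_sub]
      have hp : p i = s • p i + t • p i := by rw [← add_smul, hst, one_smul]
      nth_rewrite 1 [hp]
      abel
    rw [this, inner_add_left, real_inner_smul_left, real_inner_smul_left]
    ring
  have hcc : ∀ a ∈ stdSimplex ℝ ι, ConcaveOn ℝ (stdSimplex ℝ ι) (fun b => F a b) := by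
    intro a _
    refine ⟨hcv, fun x _ y _ s t _ _ _ => le_of_eq ?_⟩
    simp only [F, smul_eq_mul, Finset.mul_sum, ← Finset.sum_add_distrib, Pi.add_apply,
      Pi.smul_apply]
    refine Finset.sum_congr rfl fun i _ => ?_
    ring
  obtain ⟨a, ha, b, hb, hab⟩ := Sion.exists_isSaddlePointOn (f := F) hne hcv
    (isCompact_stdSimplex ℝ ι)
    (fun b _ => (by fun_prop : Continuous fun a => F a b).lowerSemicontinuous.lowerSemicontinuousOn _)
    (fun b hb => (hcx b hb).quasiconvexOn)
    hcv hne (isCompact_stdSimplex ℝ ι)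
    (fun a _ => (by fun_prop : Continuous fun b => F a b).upperSemicontinuous.upperSemicontinuousOn _)
    (fun a ha => (hcc a ha).quasiconcaveOn)
  -- On the diagonal, monotonicity replaces each `G (p i)` by `G` at the barycentre, and the
  -- `b`-weighted deviations from the barycentre sum to zero.
  have hbb : F b b ≤ 0 := by
    have h1 : F b b ≤ ∑ i, b i * inner ℝ ((∑ j, b j • p j) - p i) (G (∑ j, b j • p j)) := by
      refine Finset.sum_le_sum fun i _ => mul_le_mul_of_nonneg_left ?_ (hb.1 i)
      have := hG (∑ j, b j • p j) (p i)
      rw [inner_sub_right] at this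
      linarith
    refine h1.trans (le_of_eq ?_)
    simp only [← real_inner_smul_left]
    rw [← sum_inner]
    simp only [smul_sub, Finset.sum_sub_distrib, ← Finset.sum_smul, hb.2, one_smul, sub_self,
      inner_zero_left]
  refine ⟨a, ha, fun i => ?_⟩
  have h := (hab b hb (Pi.single i 1) (single_mem_stdSimplex ℝ i)).trans hbb
  have h2 : F a (Pi.single i 1) = inner ℝ ((∑ j, a j • p j) - p i) (G (p i)) := by
    simp only [F]
    rw [Finset.sum_eq_single i]
    · simp
    · intro j _ hj
      simp [hj]
    · simp
  rw [h2, ← neg_sub, inner_neg_left] at h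
  linarith

variable [FiniteDimensional ℝ E]

/-- Minty–Browder in finite dimension: a continuous strongly monotone map is surjective. -/
theorem surjective_of_stronglyMonotone {G : E → E} (hGc : Continuous G) {c : ℝ} (hc : 0 < c)
    (hG : ∀ x y, c * ‖x - y‖ ^ 2 ≤ inner ℝ (x - y) (G x - G y)) : Function.Surjective G := by
  intro b
  wlog hb : b = 0 generalizing G b
  · obtain ⟨x, hx⟩ := this (G := fun x => G x - b) (by fun_prop) (by simpa using hG) 0 rfl
    exact ⟨x, sub_eq_zero.1 hx⟩
  subst hb
  have : ProperSpace E := FiniteDimensional.proper ℝ E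
  have hG0 : ∀ x y, 0 ≤ inner ℝ (x - y) (G x - G y) := fun x y => le_trans (by positivity) (hG x y)
  -- A zero of `G` has norm at most `‖G 0‖ / c`; the extra `1` keeps the solution found in the ball
  -- off its boundary.
  set R : ℝ := ‖G 0‖ / c + 1 with hR
  have hRpos : 0 < R := by positivity
  -- Compactness of the ball passes from finitely many Minty inequalities to all of them at once.
  obtain ⟨x, hxK, hx⟩ := (isCompact_closedBall (0 : E) R).inter_iInter_nonempty
    (fun y : Metric.closedBall (0 : E) R => {x : E | 0 ≤ inner ℝ ((y : E) - x) (G y)})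
    (fun y => isClosed_le (by fun_prop) (by fun_prop)) (by
      intro u
      rcases u.eq_empty_or_nonempty with rfl | hu
      · exact ⟨0, by simp [hRpos.le]⟩
      have : Nonempty u := hu.to_subtype
      obtain ⟨a, ha, h⟩ := exists_mem_stdSimplex_forall_inner_nonneg hG0
        (fun i : u => ((i : Metric.closedBall (0 : E) R) : E))
      refine ⟨∑ j : u, a j • ((j : Metric.closedBall (0 : E) R) : E), ?_, ?_⟩
      · exact (convex_closedBall (0 : E) R).sum_mem (fun i _ => ha.1 i) ha.2
          (fun i _ => i.1.2)
      · simp only [Set.mem_iInter]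
        exact fun i hi => h ⟨i, hi⟩)
  have hminty : ∀ y ∈ Metric.closedBall (0 : E) R, 0 ≤ inner ℝ (y - x) (G y) := by
    intro y hy
    exact Set.mem_iInter.1 hx ⟨y, hy⟩
  -- Minty's trick: test at `x + t(z - x)`, divide by `t`, and let `t` decrease to `0`.
  have hvi : ∀ z ∈ Metric.closedBall (0 : E) R, 0 ≤ inner ℝ (z - x) (G x) := by
    intro z hz
    have hlim : Tendsto (fun t : ℝ => inner ℝ (z - x) (G (x + t • (z - x)))) (𝓝[>] 0)
        (𝓝 (inner ℝ (z - x) (G x))) := by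
      have hcont : Continuous fun t : ℝ => (inner ℝ (z - x) (G (x + t • (z - x))) : ℝ) := by
        fun_prop
      have := (hcont.tendsto 0).mono_left (nhdsWithin_le_nhds (s := Set.Ioi 0))
      simpa using this
    refine ge_of_tendsto hlim ?_
    filter_upwards [Ioc_mem_nhdsGT (zero_lt_one' ℝ)] with t ht
    have hmem : x + t • (z - x) ∈ Metric.closedBall (0 : E) R :=
      (convex_closedBall (0 : E) R).add_smul_sub_mem hxK hz ⟨ht.1.le, ht.2⟩
    have := hminty _ hmem
    rw [add_sub_cancel_left, real_inner_smul_left] at this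
    exact nonneg_of_mul_nonneg_right this ht.1
  -- Testing with `z = 0` and using strong monotonicity between `x` and `0` gives `c‖x‖² ≤ ‖x‖‖G
  -- 0‖`.
  have hxR : ‖x‖ < R := by
    have h0 := hvi 0 (by simp [hRpos.le])
    have h1 := hG x 0
    simp only [sub_zero, zero_sub, inner_neg_left, inner_sub_right] at h0 h1
    have h2 := abs_le.1 (abs_real_inner_le_norm x (G 0))
    by_contra! hcon
    have h3 : c * ‖x‖ ≤ ‖G 0‖ := by
      have hxp : 0 < ‖x‖ := hRpos.trans_le hcon
      refine le_of_mul_le_mul_left ?_ hxp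
      nlinarith
    have h4 : ‖x‖ ≤ ‖G 0‖ / c := by
      rw [le_div_iff₀ hc]; linarith
    linarith
  refine ⟨x, ?_⟩
  by_contra hne
  have hpos : 0 < ‖G x‖ := norm_pos_iff.2 hne
  -- As `x` is interior, a step of length `R - ‖x‖` along `-G x` stays in the ball and violates the
  -- variational inequality.
  have hs : 0 < (R - ‖x‖) / ‖G x‖ := by
    have : 0 < R - ‖x‖ := by linarith
    positivity
  have := hvi (x - ((R - ‖x‖) / ‖G x‖) • G x) (by
    rw [mem_closedBall_zero_iff]
    refine (norm_sub_le _ _).trans ?_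
    rw [norm_smul, Real.norm_of_nonneg hs.le, div_mul_cancel₀ _ hpos.ne']
    linarith)
  rw [sub_sub_cancel_left, inner_neg_left, real_inner_smul_left, real_inner_self_eq_norm_sq] at this
  have : 0 < (R - ‖x‖) / ‖G x‖ * ‖G x‖ ^ 2 := by positivity
  linarith

end Monotone

/-! ### Markov kernels that contract Lipschitz functions -/

section InvariantMeasure

lemma integral_measure_comp {α β : Type*} [MeasurableSpace α] [MeasurableSpace β]
    {μ : Measure α} {κ : Kernel α β} {h : β → ℝ} (hh : Integrable h (κ ∘ₘ μ)) :
    ∫ y, h y ∂(κ ∘ₘ μ) = ∫ x, ∫ y, h y ∂(κ x) ∂μ := by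
  rw [Measure.comp_eq_comp_const_apply] at hh ⊢
  rw [Kernel.integral_comp hh, Kernel.const_apply]

variable {E : Type*} [NormedAddCommGroup E] [MeasurableSpace E] [BorelSpace E]

/-- Bounded Lipschitz functions determine weak convergence, so the constant sequence `μ` converges
to `ν`; limits in the weak topology are unique. -/
lemma ext_of_forall_integral_eq_of_lipschitz {μ ν : Measure E} [IsProbabilityMeasure μ]
    [IsProbabilityMeasure ν]
    (h : ∀ (g : E → ℝ) (C : ℝ) (K : ℝ≥0), (∀ x, |g x| ≤ C) → LipschitzWith K g →
      ∫ x, g x ∂μ = ∫ x, g x ∂ν) : μ = ν := by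
  let μ' : ProbabilityMeasure E := ⟨μ, inferInstance⟩
  let ν' : ProbabilityMeasure E := ⟨ν, inferInstance⟩
  have hlim : Tendsto (fun _ : ℕ => μ') atTop (𝓝 ν') := by
    refine tendsto_iff_forall_lipschitz_integral_tendsto.2 ?_
    rintro g ⟨C, hC⟩ ⟨K, hK⟩
    have hb : ∀ x, |g x| ≤ C + |g 0| := fun x => by
      have h1 := hC x 0
      rw [Real.dist_eq] at h1
      have h2 := abs_sub_abs_le_abs_sub (g x) (g 0)
      linarith
    have heq : ∫ x, g x ∂(μ' : Measure E) = ∫ x, g x ∂(ν' : Measure E) := h g _ K hb hK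
    rw [heq]
    exact tendsto_const_nhds
  have : μ' = ν' := tendsto_nhds_unique tendsto_const_nhds hlim
  exact congrArg Subtype.val this

variable {κ : Kernel E E} [IsMarkovKernel κ] {r : ℝ≥0}

/-- The transition operator `h ↦ ∫ h(y) κ(·, dy)` of a Markov kernel. -/
noncomputable def transitionOperator (κ : Kernel E E) (h : E → ℝ) (x : E) : ℝ := ∫ y, h y ∂(κ x)

/-- The Markov kernel `κ` multiplies the Lipschitz constant of bounded Lipschitz functions
by at most `r`. -/
def ContractsLipschitz (κ : Kernel E E) (r : ℝ≥0) : Prop :=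
  ∀ (h : E → ℝ) (C : ℝ) (K : ℝ≥0), (∀ x, |h x| ≤ C) → LipschitzWith K h →
    LipschitzWith (r * K) (transitionOperator κ h)

lemma integrable_of_lipschitz_of_bounded {μ : Measure E} [IsProbabilityMeasure μ] {h : E → ℝ}
    {C : ℝ} {K : ℝ≥0} (hC : ∀ x, |h x| ≤ C) (hK : LipschitzWith K h) : Integrable h μ :=
  .of_bound hK.continuous.measurable.aestronglyMeasurable C (ae_of_all _ hC)

omit [NormedAddCommGroup E] [BorelSpace E] in
lemma abs_transitionOperator_le {h : E → ℝ} {C : ℝ} (hC : ∀ x, |h x| ≤ C) (x : E) :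
    |transitionOperator κ h x| ≤ C := by
  have := norm_integral_le_of_norm_le_const (μ := κ x) (f := h) (C := C)
    (ae_of_all _ fun y => hC y)
  simpa [transitionOperator] using this

omit [BorelSpace E] in
lemma ContractsLipschitz.iterate (hκ : ContractsLipschitz κ r) {h : E → ℝ} {C : ℝ} {K : ℝ≥0}
    (hC : ∀ x, |h x| ≤ C) (hK : LipschitzWith K h) (n : ℕ) :
    (∀ x, |(transitionOperator κ)^[n] h x| ≤ C) ∧
      LipschitzWith (r ^ n * K) ((transitionOperator κ)^[n] h) := by
  induction n with
  | zero => simpa using ⟨hC, hK⟩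
  | succ n ih =>
    rw [Function.iterate_succ_apply', pow_succ', mul_assoc]
    exact ⟨abs_transitionOperator_le ih.1, hκ _ C _ ih.1 ih.2⟩

instance isProbabilityMeasure_iterate_comp (μ : Measure E) [IsProbabilityMeasure μ] (n : ℕ) :
    IsProbabilityMeasure ((fun ν : Measure E => κ ∘ₘ ν)^[n] μ) := by
  induction n with
  | zero => simpa
  | succ n ih =>
    rw [Function.iterate_succ_apply']
    infer_instance

lemma ContractsLipschitz.integral_iterate (hκ : ContractsLipschitz κ r) {h : E → ℝ} {C : ℝ}
    {K : ℝ≥0} (hC : ∀ x, |h x| ≤ C) (hK : LipschitzWith K h) (μ : Measure E)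
    [IsProbabilityMeasure μ] (n : ℕ) :
    ∫ x, h x ∂((fun ν : Measure E => κ ∘ₘ ν)^[n] μ) = ∫ x, (transitionOperator κ)^[n] h x ∂μ := by
  induction n generalizing h K with
  | zero => rfl
  | succ n ih =>
    rw [Function.iterate_succ_apply', Function.iterate_succ_apply]
    rw [integral_measure_comp (integrable_of_lipschitz_of_bounded hC hK)]
    exact ih (abs_transitionOperator_le hC) (hκ h C K hC hK)

/-- The `n`-th iterate has Lipschitz constant `r ^ n * K`, so its differences vanish pointwise. The
uniform bound `C` allows dominated convergence without any moment of `μ`. -/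
lemma ContractsLipschitz.tendsto_integral_iterate_sub (hκ : ContractsLipschitz κ r) (hr : r < 1)
    {h : E → ℝ} {C : ℝ} {K : ℝ≥0} (hC : ∀ x, |h x| ≤ C) (hK : LipschitzWith K h) (μ : Measure E)
    [IsProbabilityMeasure μ] (x₀ : E) :
    Tendsto (fun n => ∫ x, (transitionOperator κ)^[n] h x ∂μ - (transitionOperator κ)^[n] h x₀)
      atTop (𝓝 0) := by
  have hit := hκ.iterate hC hK
  have hlim : Tendsto (fun n => ∫ x, ((transitionOperator κ)^[n] h x
      - (transitionOperator κ)^[n] h x₀) ∂μ) atTop (𝓝 (∫ _, (0 : ℝ) ∂μ)) := by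
    refine tendsto_integral_of_dominated_convergence (fun _ => C + C) (fun n => ?_)
      (integrable_const _) (fun n => ae_of_all _ fun x => ?_) (ae_of_all _ fun x => ?_)
    · exact ((hit n).2.continuous.sub continuous_const).measurable.aestronglyMeasurable
    · exact (abs_sub _ _).trans (add_le_add ((hit n).1 x) ((hit n).1 x₀))
    · have hb : ∀ n, ‖(transitionOperator κ)^[n] h x - (transitionOperator κ)^[n] h x₀‖
          ≤ (r : ℝ) ^ n * (K * dist x x₀) := fun n => by
        have := (hit n).2.dist_le_mul x x₀
        rw [dist_eq_norm] at this
        push_cast at this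
        rwa [mul_assoc] at this
      refine squeeze_zero_norm hb ?_
      have := (tendsto_pow_atTop_nhds_zero_of_lt_one r.2 (by exact_mod_cast hr)).mul_const
        ((K : ℝ) * dist x x₀)
      simpa using this
  simp only [integral_zero] at hlim
  refine hlim.congr fun n => ?_
  rw [integral_sub (integrable_of_lipschitz_of_bounded (hit n).1 (hit n).2) (integrable_const _)]
  simp

variable (hκ : ContractsLipschitz κ r) (hr : r < 1)
include hκ hr

lemma ContractsLipschitz.eq_of_comp_eq {μ ν : Measure E} [IsProbabilityMeasure μ]
    [IsProbabilityMeasure ν] (hμ : κ ∘ₘ μ = μ) (hν : κ ∘ₘ ν = ν) : μ = ν := by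
  refine ext_of_forall_integral_eq_of_lipschitz fun h C K hC hK => ?_
  -- The iterates at `0` converge to the integral against any invariant law, and this sequence does
  -- not depend on the law.
  have key : ∀ (π : Measure E) [IsProbabilityMeasure π], κ ∘ₘ π = π →
      Tendsto (fun n => (transitionOperator κ)^[n] h 0) atTop (𝓝 (∫ x, h x ∂π)) := by
    intro π _ hπ
    have h1 := hκ.tendsto_integral_iterate_sub hr hC hK π 0
    have h2 : ∀ n, ∫ x, (transitionOperator κ)^[n] h x ∂π = ∫ x, h x ∂π := fun n => by
      rw [← hκ.integral_iterate hC hK π n, Function.iterate_fixed hπ]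
    simp only [h2] at h1
    simpa using (tendsto_const_nhds (x := ∫ x, h x ∂π)).sub h1
  exact tendsto_nhds_unique (key μ hμ) (key ν hν)

variable [ProperSpace E] [SecondCountableTopology E] {c : ℝ≥0∞} (hc : c ≠ ∞)
    (hmom : ∀ x, ∫⁻ y, ‖y‖ₑ ∂(κ x) ≤ r * ‖x‖ₑ + c)
include hc hmom

/-- A Krylov–Bogoliubov argument in which the contraction replaces time averaging: the laws at times
`n` and `n + 1` become indistinguishable to bounded Lipschitz functions. -/
lemma ContractsLipschitz.exists_comp_eq :
    ∃ π : Measure E, IsProbabilityMeasure π ∧ κ ∘ₘ π = π := by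
  let μ : ℕ → ProbabilityMeasure E := fun n =>
    ⟨(fun ν : Measure E => κ ∘ₘ ν)^[n] (Measure.dirac 0), inferInstance⟩
  have hμ : ∀ n, ((μ n : ProbabilityMeasure E) : Measure E)
    = (fun ν : Measure E => κ ∘ₘ ν)^[n] (Measure.dirac 0) := fun _ => rfl
  -- The fixed point of `s ↦ r s + c`, so the moment bound `M` reproduces itself under the drift
  -- condition.
  set M : ℝ≥0∞ := c / (1 - r) with hM
  have hr1 : (1 - r : ℝ≥0∞) ≠ 0 := by
    have : (r : ℝ≥0∞) < 1 := by exact_mod_cast hr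
    exact (tsub_pos_of_lt this).ne'
  have hMtop : M ≠ ∞ := ENNReal.div_ne_top hc hr1
  have hMeq : r * M + c = M := by
    have h1 : M * (1 - r) = c := ENNReal.div_mul_cancel hr1 (by simp)
    have h2 : (r : ℝ≥0∞) + (1 - r) = 1 := add_tsub_cancel_of_le (by exact_mod_cast hr.le)
    calc r * M + c = M * (r + (1 - r)) := by rw [mul_add, h1, mul_comm]
      _ = M := by rw [h2, mul_one]
  have hmoment : ∀ n, ∫⁻ x, ‖x‖ₑ ∂(μ n : Measure E) ≤ M := by
    intro n
    induction n with
    | zero => simp [hμ]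
    | succ n ih =>
      rw [hμ, Function.iterate_succ_apply', ← hμ,
        Measure.lintegral_bind κ.measurable.aemeasurable (by fun_prop)]
      calc ∫⁻ x, ∫⁻ y, ‖y‖ₑ ∂(κ x) ∂(μ n : Measure E)
          ≤ ∫⁻ x, (r * ‖x‖ₑ + c) ∂(μ n : Measure E) := lintegral_mono hmom
        _ = r * ∫⁻ x, ‖x‖ₑ ∂(μ n : Measure E) + c := by
            rw [lintegral_add_right _ measurable_const, lintegral_const_mul _ (by fun_prop)]
            simp
        _ ≤ M := by
            rw [← hMeq]
            gcongr
  have htight : IsTightMeasureSet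
      {((ν : ProbabilityMeasure E) : Measure E) | ν ∈ Set.range μ} := by
    refine isTightMeasureSet_of_tendsto_measure_norm_gt ?_
    have hlim : Tendsto (fun R : ℝ => M / ENNReal.ofReal R) atTop (𝓝 0) := by
      have := ENNReal.Tendsto.const_div ENNReal.tendsto_ofReal_atTop (Or.inr hMtop)
      simpa using this
    refine tendsto_of_tendsto_of_tendsto_of_le_of_le' tendsto_const_nhds hlim
      (Eventually.of_forall fun _ => bot_le) ?_
    filter_upwards [eventually_gt_atTop 0] with R hR
    refine iSup₂_le ?_
    rintro _ ⟨_, ⟨n, rfl⟩, rfl⟩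
    refine le_trans (measure_mono fun x hx => ?_)
      ((meas_ge_le_lintegral_div (f := fun x : E => ‖x‖ₑ) (by fun_prop)
        (by simpa using hR) ENNReal.ofReal_ne_top).trans
        (ENNReal.div_le_div_right (hmoment n) _))
    change ENNReal.ofReal R ≤ ‖x‖ₑ
    rw [← ofReal_norm]
    exact ENNReal.ofReal_le_ofReal (le_of_lt hx)
  obtain ⟨π, -, hπ⟩ := (isCompact_closure_of_isTightMeasureSet htight).exists_mapClusterPt
    (f := atTop) (u := μ)
    (le_principal_iff.2 (mem_map.2 (univ_mem' fun n => subset_closure ⟨n, rfl⟩)))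
  -- An ultrafilter finer than `atTop` turns the cluster point into a genuine limit.
  obtain ⟨U, hU, hlim⟩ := mapClusterPt_iff_ultrafilter.1 hπ
  have hconv : ∀ (h : E → ℝ) (C : ℝ) (K : ℝ≥0), (∀ x, |h x| ≤ C) → LipschitzWith K h →
      Tendsto (fun n => (transitionOperator κ)^[n] h 0) U (𝓝 (∫ x, h x ∂(π : Measure E))) := by
    intro h C K hC hK
    let h' : BoundedContinuousFunction E ℝ :=
      BoundedContinuousFunction.ofNormedAddCommGroup h hK.continuous C hC
    have := ProbabilityMeasure.tendsto_iff_forall_integral_tendsto.1 hlim h'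
    refine this.congr fun n => ?_
    change ∫ x, h x ∂(μ n : Measure E) = _
    rw [hμ, hκ.integral_iterate hC hK, integral_dirac]
  refine ⟨π, inferInstance, ext_of_forall_integral_eq_of_lipschitz fun h C K hC hK => ?_⟩
  rw [integral_measure_comp (integrable_of_lipschitz_of_bounded hC hK)]
  have h1 := hconv h C K hC hK
  have h2 := hconv _ C _ (abs_transitionOperator_le (κ := κ) hC) (hκ h C K hC hK)
  -- With initial law `κ 0`, this compares the chain started one step later with the chain itself;
  -- the difference tends to zero.
  have h3 := (hκ.tendsto_integral_iterate_sub hr hC hK (κ 0) 0).mono_left hU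
  have h4 : ∀ n, (transitionOperator κ)^[n] (transitionOperator κ h) 0
      = ∫ x, (transitionOperator κ)^[n] h x ∂(κ 0) := fun n => by
    rw [← Function.iterate_succ_apply, Function.iterate_succ_apply']
    rfl
  simp only [h4] at h2
  have h5 := tendsto_nhds_unique (h2.sub h1) h3
  exact sub_eq_zero.1 h5

/-- A Markov kernel which contracts bounded Lipschitz functions and satisfies a first moment
drift condition has exactly one invariant probability measure. -/
theorem ContractsLipschitz.existsUnique_comp_eq :
    ∃! π : Measure E, IsProbabilityMeasure π ∧ κ ∘ₘ π = π := by
  obtain ⟨π, hπ, hπκ⟩ := hκ.exists_comp_eq hr hc hmom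
  refine ⟨π, ⟨hπ, hπκ⟩, ?_⟩
  rintro π' ⟨hπ', hπ'κ⟩
  exact hκ.eq_of_comp_eq hr hπ'κ hπκ

end InvariantMeasure

/-! ### Iterated random maps with independent noise -/

section RandomMap

variable {E W Ω : Type*} [MeasurableSpace E] [MeasurableSpace W] [mΩ : MeasurableSpace Ω]

/-- The Markov kernel `x ↦ law of Φ(x, ξ)`, where `ξ` has law `μ`. -/
noncomputable def randomMapKernel (Φ : E × W → E) (μ : Measure W) : Kernel E E :=
  (Kernel.id ×ₖ Kernel.const E μ).map Φ

variable {Φ : E × W → E} {μ : Measure W} [IsProbabilityMeasure μ]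

lemma randomMapKernel_apply (hΦ : Measurable Φ) (x : E) :
    randomMapKernel Φ μ x = μ.map (fun w => Φ (x, w)) := by
  rw [randomMapKernel, Kernel.map_apply _ hΦ, Kernel.prod_apply, Kernel.id_apply,
    Kernel.const_apply, Measure.dirac_prod, Measure.map_map hΦ measurable_prodMk_left]
  rfl

lemma isMarkovKernel_randomMapKernel (hΦ : Measurable Φ) :
    IsMarkovKernel (randomMapKernel Φ μ) := Kernel.IsMarkovKernel.map _ hΦ

lemma randomMapKernel_comp (hΦ : Measurable Φ) (ρ : Measure E) [IsProbabilityMeasure ρ] :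
    randomMapKernel Φ μ ∘ₘ ρ = (ρ.prod μ).map Φ := by
  ext S hS
  rw [Measure.bind_apply hS (Kernel.aemeasurable _), Measure.map_apply hΦ hS,
    Measure.prod_apply (hΦ hS)]
  refine lintegral_congr fun x => ?_
  rw [randomMapKernel_apply hΦ]
  exact Measure.map_apply (hΦ.comp measurable_prodMk_left) hS

/-- The chain `x`, `Φ(x, ξ₀)`, `Φ(Φ(x, ξ₀), ξ₁)`, … driven by the noise `ξ`. -/
def randomMapChain (Φ : E × W → E) (ξ : ℕ → Ω → W) (x : E) : ℕ → Ω → E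
  | 0, _ => x
  | n + 1, ω => Φ (randomMapChain Φ ξ x n ω, ξ n ω)

omit mΩ in
-- The filtration is left free: the noise filtration gives independence of the next increment, while
-- a constant one gives plain measurability.
lemma measurable_randomMapChain (hΦ : Measurable Φ) {ξ : ℕ → Ω → W}
    {F : ℕ → MeasurableSpace Ω} (hF : Monotone F) (hξ : ∀ n, Measurable[F (n + 1)] (ξ n)) (x : E)
    (n : ℕ) : Measurable[F n] (randomMapChain Φ ξ x n) := by
  induction n with
  | zero => exact measurable_const
  | succ n ih => exact hΦ.comp ((ih.mono (hF n.le_succ) le_rfl).prodMk (hξ n))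

/-- The law of the chain driven by independent identically distributed noise. -/
lemma map_randomMapChain (hΦ : Measurable Φ) {P : Measure Ω} [IsProbabilityMeasure P]
    {ξ : ℕ → Ω → W} {F : ℕ → MeasurableSpace Ω} (hF : Monotone F) (hFle : ∀ n, F n ≤ mΩ)
    (hξ : ∀ n, Measurable[F (n + 1)] (ξ n))
    (hindep : ∀ n, Indep (F n) (MeasurableSpace.comap (ξ n) inferInstance) P)
    (hlaw : ∀ n, P.map (ξ n) = μ) (x : E) (n : ℕ) :
    P.map (randomMapChain Φ ξ x n)
      = (fun ρ : Measure E => randomMapKernel Φ μ ∘ₘ ρ)^[n] (Measure.dirac x) := by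
  have hZF := measurable_randomMapChain hΦ hF hξ x
  have hZ : ∀ n, Measurable (randomMapChain Φ ξ x n) := fun n => (hZF n).mono (hFle n) le_rfl
  have hξm : ∀ n, Measurable (ξ n) := fun n => (hξ n).mono (hFle _) le_rfl
  induction n with
  | zero =>
    change P.map (fun _ => x) = _
    simp
  | succ n ih =>
    have hi : IndepFun (randomMapChain Φ ξ x n) (ξ n) P :=
      indep_of_indep_of_le_left (hindep n) (hZF n).comap_le
    have := Measure.isProbabilityMeasure_map (μ := P) (hZ n).aemeasurable
    rw [Function.iterate_succ_apply', ← ih, randomMapKernel_comp hΦ, ← hlaw n,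
      ← (indepFun_iff_map_prod_eq_prod_map_map (hZ n).aemeasurable (hξm n).aemeasurable).1 hi,
      Measure.map_map hΦ ((hZ n).prodMk (hξm n))]
    rfl

end RandomMap

/-! ### Regrouping independent σ-algebras -/

section Independence

variable {Ω : Type*} {mΩ : MeasurableSpace Ω} {P : Measure Ω}

lemma sup_eq_generateFrom_inter (m₁ m₂ : MeasurableSpace Ω) :
    m₁ ⊔ m₂ = MeasurableSpace.generateFrom
      {s | ∃ a b, MeasurableSet[m₁] a ∧ MeasurableSet[m₂] b ∧ a ∩ b = s} := by
  refine le_antisymm (sup_le ?_ ?_) (MeasurableSpace.generateFrom_le ?_)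
  · exact fun a ha => MeasurableSpace.measurableSet_generateFrom
      ⟨a, Set.univ, ha, MeasurableSet.univ, Set.inter_univ a⟩
  · exact fun b hb => MeasurableSpace.measurableSet_generateFrom
      ⟨Set.univ, b, MeasurableSet.univ, hb, Set.univ_inter b⟩
  · rintro _ ⟨a, b, ha, hb, rfl⟩
    exact MeasurableSet.inter ((le_sup_left : m₁ ≤ m₁ ⊔ m₂) a ha)
      ((le_sup_right : m₂ ≤ m₁ ⊔ m₂) b hb)

lemma isPiSystem_inter (m₁ m₂ : MeasurableSpace Ω) :
    IsPiSystem {s | ∃ a b, MeasurableSet[m₁] a ∧ MeasurableSet[m₂] b ∧ a ∩ b = s} := by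
  rintro _ ⟨a, b, ha, hb, rfl⟩ _ ⟨a', b', ha', hb', rfl⟩ -
  exact ⟨a ∩ a', b ∩ b', MeasurableSet.inter ha ha', MeasurableSet.inter hb hb',
    Set.inter_inter_inter_comm a a' b b'⟩

/-- If two pairs of independent σ-algebras are independent of each other, then the four
σ-algebras can be regrouped. -/
lemma indep_sup_sup [IsProbabilityMeasure P] {m₁ m₂ m₃ m₄ : MeasurableSpace Ω} (h₁ : m₁ ≤ mΩ)
    (h₂ : m₂ ≤ mΩ) (h₃ : m₃ ≤ mΩ) (h₄ : m₄ ≤ mΩ) (h₁₂ : Indep m₁ m₂ P) (h₃₄ : Indep m₃ m₄ P)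
    (h : Indep (m₁ ⊔ m₂) (m₃ ⊔ m₄) P) : Indep (m₁ ⊔ m₃) (m₂ ⊔ m₄) P := by
  refine IndepSets.indep (sup_le h₁ h₃) (sup_le h₂ h₄) (isPiSystem_inter m₁ m₃)
    (isPiSystem_inter m₂ m₄) (sup_eq_generateFrom_inter _ _) (sup_eq_generateFrom_inter _ _) ?_
  rw [IndepSets_iff]
  rintro _ _ ⟨a, c, ha, hc, rfl⟩ ⟨b, d, hb, hd, rfl⟩
  rw [Indep_iff] at h₁₂ h₃₄ h
  have hl₁ : ∀ s, MeasurableSet[m₁] s → MeasurableSet[m₁ ⊔ m₂] s := le_sup_left (a := m₁) (b := m₂)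
  have hl₂ : ∀ s, MeasurableSet[m₂] s → MeasurableSet[m₁ ⊔ m₂] s := le_sup_right (a := m₁) (b := m₂)
  have hl₃ : ∀ s, MeasurableSet[m₃] s → MeasurableSet[m₃ ⊔ m₄] s := le_sup_left (a := m₃) (b := m₄)
  have hl₄ : ∀ s, MeasurableSet[m₄] s → MeasurableSet[m₃ ⊔ m₄] s := le_sup_right (a := m₃) (b := m₄)
  rw [Set.inter_inter_inter_comm, h _ _ ((hl₁ a ha).inter (hl₂ b hb)) ((hl₃ c hc).inter (hl₄ d hd)),
    h₁₂ _ _ ha hb, h₃₄ _ _ hc hd, h _ _ (hl₁ a ha) (hl₃ c hc), h _ _ (hl₂ b hb) (hl₄ d hd)]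
  ring

end Independence

/-! ### Increments of the driving noise over a time grid -/

section Increments

variable {Ω : Type*} [mΩ : MeasurableSpace Ω] {P : Measure Ω} {d m : ℕ}

/-- The `n`-th increment of a process over a time grid of mesh `δ`. -/
def gridIncrement {E : Type*} [Sub E] (X : ℝ≥0 → Ω → E) (δ : ℝ≥0) (n : ℕ) (ω : Ω) : E :=
  X (((n + 1 : ℕ) : ℝ≥0) * δ) ω - X ((n : ℝ≥0) * δ) ω

lemma monotone_natCast_mul (δ : ℝ≥0) : Monotone (fun n : ℕ => (n : ℝ≥0) * δ) :=
  fun _ _ hab => mul_le_mul_left (Nat.cast_le.2 hab) δ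

variable {B : ℝ≥0 → Ω → EuclideanSpace ℝ (Fin m)} {L : ℝ≥0 → Ω → EuclideanSpace ℝ (Fin d)}

lemma IsBrownianVector.measurable_gridIncrement (hB : IsBrownianVector P B) (δ : ℝ≥0) (n : ℕ) :
    Measurable (gridIncrement B δ n) := (hB.measurable _).sub (hB.measurable _)

lemma IsLevyProcess.measurable_gridIncrement (hL : IsLevyProcess P L) (δ : ℝ≥0) (n : ℕ) :
    Measurable (gridIncrement L δ n) := (hL.measurable _).sub (hL.measurable _)

/-- Independence of the coordinate paths and of the increments within each path combine into joint
independence over all pairs (coordinate, time index). -/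
lemma IsBrownianVector.iIndepFun_gridIncrement [IsProbabilityMeasure P]
    (hB : IsBrownianVector P B) (δ : ℝ≥0) :
    iIndepFun (fun (p : Fin m × ℕ) ω => gridIncrement B δ p.2 ω p.1) P := by
  refine iIndepFun_uncurry' (X := fun j n ω => gridIncrement B δ n ω j) (fun j n => ?_) ?_ ?_
  · exact (EuclideanSpace.proj (𝕜 := ℝ) j).measurable.comp (hB.measurable_gridIncrement δ n)
  · exact hB.indep.comp
      (fun _ (p : ℝ≥0 → ℝ) (n : ℕ) => p (((n + 1 : ℕ) : ℝ≥0) * δ) - p ((n : ℝ≥0) * δ))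
      (fun _ => by fun_prop)
  · exact fun j => (hB.brownian j).toIsPreBrownianReal.hasIndepIncrements.nat
      (monotone_natCast_mul δ)

lemma IsBrownianVector.iIndepFun_gridIncrement_coord [IsProbabilityMeasure P]
    (hB : IsBrownianVector P B) (δ : ℝ≥0) (n : ℕ) :
    iIndepFun (fun (j : Fin m) ω => gridIncrement B δ n ω j) P :=
  (hB.iIndepFun_gridIncrement δ).precomp (g := fun j => (j, n)) fun _ _ h => congrArg Prod.fst h

lemma IsBrownianVector.hasLaw_gridIncrement_coord (hB : IsBrownianVector P B) (δ : ℝ≥0) (n : ℕ)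
    (j : Fin m) : HasLaw (fun ω => gridIncrement B δ n ω j) (gaussianReal 0 δ) P := by
  have h := (hB.brownian j).toIsPreBrownianReal.hasLaw_sub
    (((n + 1 : ℕ) : ℝ≥0) * δ) ((n : ℝ≥0) * δ)
  have hd : nndist ((((n + 1 : ℕ) : ℝ≥0) * δ : ℝ≥0) : ℝ) (((n : ℝ≥0) * δ : ℝ≥0) : ℝ) = δ := by
    ext
    rw [coe_nndist, Real.dist_eq]
    push_cast
    rw [← sub_mul, add_sub_cancel_left, one_mul]
    exact abs_of_nonneg δ.2
  have h' := h
  erw [hd] at h'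
  exact h'

lemma IsBrownianVector.map_gridIncrement [IsProbabilityMeasure P] (hB : IsBrownianVector P B)
    (δ : ℝ≥0) (n : ℕ) :
    P.map (gridIncrement B δ n)
      = (Measure.pi fun _ : Fin m => gaussianReal 0 δ).map (WithLp.toLp 2) := by
  have h := (hB.iIndepFun_gridIncrement_coord δ n).map_fun_eq_pi_map
    (fun j => (hB.hasLaw_gridIncrement_coord δ n j).aemeasurable)
  simp only [(hB.hasLaw_gridIncrement_coord δ n _).map_eq] at h
  rw [← h, Measure.map_map (by fun_prop)]
  · rfl
  · exact measurable_pi_lambda _ fun j =>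
      (EuclideanSpace.proj (𝕜 := ℝ) j).measurable.comp (hB.measurable_gridIncrement δ n)

lemma IsLevyProcess.identDistrib_gridIncrement (hL : IsLevyProcess P L) (δ : ℝ≥0) (n : ℕ) :
    IdentDistrib (gridIncrement L δ n) (L δ) P P := by
  have h := hL.stationary_increments ((n : ℝ≥0) * δ) δ
  have ht : (n : ℝ≥0) * δ + δ = ((n + 1 : ℕ) : ℝ≥0) * δ := by push_cast; ring
  rwa [ht] at h

lemma indepFun_gridIncrement (hBL : IndepFun (fun ω t => B t ω) (fun ω t => L t ω) P)
    (δ : ℝ≥0) (n : ℕ) : IndepFun (gridIncrement B δ n) (gridIncrement L δ n) P :=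
  hBL.comp
    (φ := fun p : ℝ≥0 → EuclideanSpace ℝ (Fin m) =>
      p (((n + 1 : ℕ) : ℝ≥0) * δ) - p ((n : ℝ≥0) * δ))
    (ψ := fun p : ℝ≥0 → EuclideanSpace ℝ (Fin d) =>
      p (((n + 1 : ℕ) : ℝ≥0) * δ) - p ((n : ℝ≥0) * δ)) (by fun_prop) (by fun_prop)

/-- The joint increments of the Brownian motion and the Lévy process over a time grid. -/
def gridNoise (B : ℝ≥0 → Ω → EuclideanSpace ℝ (Fin m)) (L : ℝ≥0 → Ω → EuclideanSpace ℝ (Fin d))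
    (δ : ℝ≥0) (n : ℕ) (ω : Ω) : EuclideanSpace ℝ (Fin m) × EuclideanSpace ℝ (Fin d) :=
  (gridIncrement B δ n ω, gridIncrement L δ n ω)

lemma measurable_gridNoise (hB : IsBrownianVector P B) (hL : IsLevyProcess P L) (δ : ℝ≥0) (n : ℕ) :
    Measurable (gridNoise B L δ n) :=
  (hB.measurable_gridIncrement δ n).prodMk (hL.measurable_gridIncrement δ n)

lemma map_gridNoise [IsProbabilityMeasure P] (hB : IsBrownianVector P B) (hL : IsLevyProcess P L)
    (hBL : IndepFun (fun ω t => B t ω) (fun ω t => L t ω) P) (δ : ℝ≥0) (n : ℕ) :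
    P.map (gridNoise B L δ n) = P.map (gridNoise B L δ 0) := by
  have key : ∀ n, P.map (gridNoise B L δ n)
      = ((Measure.pi fun _ : Fin m => gaussianReal 0 δ).map (WithLp.toLp 2)).prod
        (P.map (L δ)) := fun n => by
    rw [← hB.map_gridIncrement δ n, ← (hL.identDistrib_gridIncrement δ n).map_eq]
    exact (indepFun_iff_map_prod_eq_prod_map_map (hB.measurable_gridIncrement δ n).aemeasurable
      (hL.measurable_gridIncrement δ n).aemeasurable).1 (indepFun_gridIncrement hBL δ n)
  rw [key n, key 0]

/-- The σ-algebra generated by the increments of `B` with index in `S`. -/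
abbrev brownianIncrementAlgebra (B : ℝ≥0 → Ω → EuclideanSpace ℝ (Fin m)) (δ : ℝ≥0) (S : Set ℕ) :
    MeasurableSpace Ω :=
  ⨆ p ∈ {p : Fin m × ℕ | p.2 ∈ S},
    MeasurableSpace.comap (fun ω => gridIncrement B δ p.2 ω p.1) inferInstance

/-- The σ-algebra generated by the increments of `L` with index in `S`. -/
abbrev levyIncrementAlgebra (L : ℝ≥0 → Ω → EuclideanSpace ℝ (Fin d)) (δ : ℝ≥0) (S : Set ℕ) :
    MeasurableSpace Ω :=
  ⨆ n ∈ S, MeasurableSpace.comap (gridIncrement L δ n) inferInstance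

/-- The σ-algebra generated by the joint increments with index in `S`. -/
abbrev noiseAlgebra (B : ℝ≥0 → Ω → EuclideanSpace ℝ (Fin m)) (L : ℝ≥0 → Ω → EuclideanSpace ℝ (Fin d))
    (δ : ℝ≥0) (S : Set ℕ) : MeasurableSpace Ω :=
  brownianIncrementAlgebra B δ S ⊔ levyIncrementAlgebra L δ S

omit mΩ in
lemma noiseAlgebra_mono (δ : ℝ≥0) : Monotone (noiseAlgebra B L δ) := fun _ _ hST =>
  sup_le_sup (biSup_mono fun _ hp => hST hp) (biSup_mono fun _ hn => hST hn)

omit mΩ in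
lemma measurable_gridNoise_noiseAlgebra (δ : ℝ≥0) {S : Set ℕ} {n : ℕ} (hn : n ∈ S) :
    Measurable[noiseAlgebra B L δ S] (gridNoise B L δ n) := by
  have h1 : ∀ j, Measurable[brownianIncrementAlgebra B δ S]
      (fun ω => gridIncrement B δ n ω j) := fun j => by
    refine Measurable.mono (comap_measurable _) ?_ le_rfl
    exact le_iSup₂_of_le (j, n) hn le_rfl
  have h2 : Measurable[brownianIncrementAlgebra B δ S] (gridIncrement B δ n) :=
    (WithLp.measurable_toLp 2 (Fin m → ℝ)).comp (@measurable_pi_lambda _ _ _ (brownianIncrementAlgebra B δ S) _ _ h1)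
  have h3 : Measurable[levyIncrementAlgebra L δ S] (gridIncrement L δ n) :=
    Measurable.mono (comap_measurable _) (le_iSup₂_of_le n hn le_rfl) le_rfl
  exact (h2.mono le_sup_left le_rfl).prodMk (h3.mono le_sup_right le_rfl)

lemma brownianIncrementAlgebra_le (hB : ∀ t, Measurable (B t)) (δ : ℝ≥0) (S : Set ℕ) :
    brownianIncrementAlgebra B δ S ≤ mΩ :=
  iSup₂_le fun p _ => ((EuclideanSpace.proj (𝕜 := ℝ) p.1).measurable.comp
    ((hB _).sub (hB _))).comap_le

lemma levyIncrementAlgebra_le (hL : ∀ t, Measurable (L t)) (δ : ℝ≥0) (S : Set ℕ) :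
    levyIncrementAlgebra L δ S ≤ mΩ :=
  iSup₂_le fun _ _ => ((hL _).sub (hL _)).comap_le

omit mΩ in
lemma brownianIncrementAlgebra_le_comap (δ : ℝ≥0) (S : Set ℕ) :
    brownianIncrementAlgebra B δ S
      ≤ MeasurableSpace.comap (fun ω t => B t ω) inferInstance := by
  refine iSup₂_le fun p _ => ?_
  have : Measurable fun q : ℝ≥0 → EuclideanSpace ℝ (Fin m) =>
      (q (((p.2 + 1 : ℕ) : ℝ≥0) * δ) - q ((p.2 : ℝ≥0) * δ)) p.1 := by fun_prop
  exact (this.comp (comap_measurable fun ω t => B t ω)).comap_le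

omit mΩ in
lemma levyIncrementAlgebra_le_comap (δ : ℝ≥0) (S : Set ℕ) :
    levyIncrementAlgebra L δ S ≤ MeasurableSpace.comap (fun ω t => L t ω) inferInstance := by
  refine iSup₂_le fun n _ => ?_
  have : Measurable fun q : ℝ≥0 → EuclideanSpace ℝ (Fin d) =>
      q (((n + 1 : ℕ) : ℝ≥0) * δ) - q ((n : ℝ≥0) * δ) := by fun_prop
  exact (this.comp (comap_measurable fun ω t => L t ω)).comap_le

/-- The increments of `B` over `S` and `T` are independent, likewise those of `L`, and `B` is
independent of `L`; `indep_sup_sup` regroups the four σ-algebras by index set. -/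
lemma indep_noiseAlgebra [IsProbabilityMeasure P] (hB : IsBrownianVector P B)
    (hL : IsLevyProcess P L) (hBL : IndepFun (fun ω t => B t ω) (fun ω t => L t ω) P)
    (δ : ℝ≥0) {S T : Set ℕ} (hST : Disjoint S T) :
    Indep (noiseAlgebra B L δ S) (noiseAlgebra B L δ T) P := by
  have hBle := brownianIncrementAlgebra_le hB.measurable δ
  have hLle := levyIncrementAlgebra_le hL.measurable δ
  refine indep_sup_sup (hBle S) (hBle T) (hLle S) (hLle T) ?_ ?_ ?_
  · refine indep_iSup_of_disjoint (fun p => ?_) (hB.iIndepFun_gridIncrement δ) ?_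
    · exact ((EuclideanSpace.proj (𝕜 := ℝ) p.1).measurable.comp
        (hB.measurable_gridIncrement δ p.2)).comap_le
    · exact Set.disjoint_left.2 fun p hp hp' => Set.disjoint_left.1 hST hp hp'
  · exact indep_iSup_of_disjoint (fun n => (hL.measurable_gridIncrement δ n).comap_le)
      (hL.indep_increments.nat (monotone_natCast_mul δ)) hST
  · exact indep_of_indep_of_le_left (indep_of_indep_of_le_right hBL
      (sup_le (levyIncrementAlgebra_le_comap δ S) (levyIncrementAlgebra_le_comap δ T)))
      (sup_le (brownianIncrementAlgebra_le_comap δ S) (brownianIncrementAlgebra_le_comap δ T))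

end Increments

/-! ### Second moments of Gaussian affine images -/

section GaussianMoments

variable {Ω : Type*} {mΩ : MeasurableSpace Ω} {P : Measure Ω} [IsProbabilityMeasure P] {d m : ℕ}

lemma toEuclideanLin_apply_coord (A : Matrix (Fin d) (Fin m) ℝ) (v : EuclideanSpace ℝ (Fin m))
    (i : Fin d) : A.toEuclideanLin v i = ∑ j, A i j * v j := by
  rw [Matrix.toLpLin_apply]
  rfl

/-- The second moment is the squared mean plus the variance, and the variance is additive by
independence. -/
lemma memLp_and_integral_sq_affine {β : Fin m → Ω → ℝ} {δ : ℝ≥0}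
    (hlaw : ∀ j, HasLaw (β j) (gaussianReal 0 δ) P) (hind : iIndepFun β P) (a : ℝ)
    (c : Fin m → ℝ) :
    MemLp (fun ω => a + ∑ j, c j * β j ω) 2 P ∧
      ∫ ω, (a + ∑ j, c j * β j ω) ^ 2 ∂P = a ^ 2 + δ * ∑ j, c j ^ 2 := by
  have hL2 : ∀ j, MemLp (fun ω => c j * β j ω) 2 P := fun j =>
    ((hlaw j).hasGaussianLaw.memLp_two).const_mul (c j)
  have hsum : MemLp (fun ω => ∑ j, c j * β j ω) 2 P := memLp_finsetSum _ fun j _ => hL2 j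
  have hmem : MemLp (fun ω => a + ∑ j, c j * β j ω) 2 P := (memLp_const a).add hsum
  refine ⟨hmem, ?_⟩
  have hmean : ∫ ω, (a + ∑ j, c j * β j ω) ∂P = a := by
    rw [integral_add (integrable_const a) (hsum.integrable (by norm_num)),
      integral_finsetSum _ fun j _ => (hL2 j).integrable (by norm_num)]
    simp [integral_const_mul, (hlaw _).integral_eq]
  have hvar : Var[fun ω => a + ∑ j, c j * β j ω; P] = δ * ∑ j, c j ^ 2 := by
    rw [variance_const_add hsum.aestronglyMeasurable]
    have h := IndepFun.variance_sum (μ := P) (s := Finset.univ) (X := fun j ω => c j * β j ω)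
      (fun j _ => hL2 j) (fun i _ j _ hij =>
        (hind.indepFun hij).comp (measurable_const_mul (c i)) (measurable_const_mul (c j)))
    have he : (∑ j, fun ω => c j * β j ω) = fun ω => ∑ j, c j * β j ω := by
      ext ω
      simp
    rw [he] at h
    rw [h, Finset.mul_sum]
    refine Finset.sum_congr rfl fun j _ => ?_
    rw [variance_const_mul, (hlaw j).variance_eq, variance_id_gaussianReal, mul_comm]
  have := variance_eq_sub hmem
  rw [hvar, hmean] at this
  simp only [Pi.pow_apply] at this
  linarith

/-- For a centred Gaussian vector `β` with covariance `δ • 1`, the affine image `a + A β` has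
second moment `|a|² + δ |A|²`, with the Frobenius norm of `A`. -/
lemma memLp_and_integral_norm_sq_affine {β : Ω → EuclideanSpace ℝ (Fin m)} {δ : ℝ≥0}
    (hβ : Measurable β) (hlaw : ∀ j, HasLaw (fun ω => β ω j) (gaussianReal 0 δ) P)
    (hind : iIndepFun (fun j ω => β ω j) P) (a : EuclideanSpace ℝ (Fin d))
    (A : Matrix (Fin d) (Fin m) ℝ) :
    MemLp (fun ω => a + A.toEuclideanLin (β ω)) 2 P ∧
      ∫ ω, ‖a + A.toEuclideanLin (β ω)‖ ^ 2 ∂P = ‖a‖ ^ 2 + δ * ∑ i, ∑ j, A i j ^ 2 := by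
  have hco := fun i => memLp_and_integral_sq_affine hlaw hind (a i) (A i)
  have hsq : ∀ ω, ‖a + A.toEuclideanLin (β ω)‖ ^ 2 = ∑ i, (a i + ∑ j, A i j * β ω j) ^ 2 :=
    fun ω => by
      rw [EuclideanSpace.real_norm_sq_eq]
      exact Finset.sum_congr rfl fun i _ => by
        rw [PiLp.add_apply, toEuclideanLin_apply_coord]
  have hmeas : Measurable fun ω => a + A.toEuclideanLin (β ω) :=
    measurable_const.add ((LinearMap.continuous_of_finiteDimensional _).measurable.comp hβ)
  constructor
  · rw [memLp_two_iff_integrable_sq_norm hmeas.aestronglyMeasurable]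
    simp only [hsq]
    exact integrable_finsetSum _ fun i _ => (hco i).1.integrable_sq
  · simp only [hsq]
    rw [integral_finsetSum _ fun i _ => (hco i).1.integrable_sq]
    simp only [(hco _).2]
    rw [Finset.sum_add_distrib, ← Finset.mul_sum, ← EuclideanSpace.real_norm_sq_eq]

/-- Nonnegativity of the variance of `‖Y‖`. -/
lemma integral_norm_le_sqrt {F : Type*} [NormedAddCommGroup F] {Y : Ω → F} (hY : MemLp Y 2 P) :
    ∫ ω, ‖Y ω‖ ∂P ≤ √(∫ ω, ‖Y ω‖ ^ 2 ∂P) := by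
  refine Real.le_sqrt_of_sq_le ?_
  have h1 := variance_eq_sub hY.norm
  have h2 := variance_nonneg (fun ω => ‖Y ω‖) P
  simp only [Pi.pow_apply] at h1
  linarith

end GaussianMoments

/-! ### Inverting the implicit step -/

section ImplicitStep

variable {d m : ℕ} {f : EuclideanSpace ℝ (Fin d) → EuclideanSpace ℝ (Fin d)}
  {g : EuclideanSpace ℝ (Fin d) → Matrix (Fin d) (Fin m) ℝ} {K₃ K₄ δ : ℝ}

lemma mul_norm_sub_sq_le_inner_implicit (hδ : 0 ≤ δ)
    (hf : ∀ x y, inner ℝ (x - y) (f x - f y) ≤ K₃ * ‖x - y‖ ^ 2) (x y) :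
    (1 - K₃ * δ) * ‖x - y‖ ^ 2 ≤ inner ℝ (x - y) ((x - δ • f x) - (y - δ • f y)) := by
  have h : (x - δ • f x) - (y - δ • f y) = (x - y) - δ • (f x - f y) := by
    rw [smul_sub]; abel
  rw [h, inner_sub_right, real_inner_self_eq_norm_sq, real_inner_smul_right]
  nlinarith [mul_le_mul_of_nonneg_left (hf x y) hδ]

/-- Expand the square and drop `δ²‖f x - f y‖²`. The remaining constant is affine in `δ`, ready for
comparison with `1 + K₄ δ`. -/
lemma mul_norm_sub_sq_le_implicit (hδ : 0 ≤ δ)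
    (hf : ∀ x y, inner ℝ (x - y) (f x - f y) ≤ K₃ * ‖x - y‖ ^ 2) (x y) :
    (1 - 2 * K₃ * δ) * ‖x - y‖ ^ 2 ≤ ‖(x - δ • f x) - (y - δ • f y)‖ ^ 2 := by
  have h : (x - δ • f x) - (y - δ • f y) = (x - y) - δ • (f x - f y) := by
    rw [smul_sub]; abel
  rw [h, norm_sub_sq_real (x - y), real_inner_smul_right]
  nlinarith [mul_le_mul_of_nonneg_left (hf x y) hδ, sq_nonneg ‖δ • (f x - f y)‖]

/-- For a one-sided Lipschitz drift with negative constant, the implicit step is a bijection with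
contracting inverse. -/
lemma exists_implicit_inverse (hfc : Continuous f) (hδ : 0 ≤ δ) (hK₃ : K₃ < 0)
    (hf : ∀ x y, inner ℝ (x - y) (f x - f y) ≤ K₃ * ‖x - y‖ ^ 2) :
    ∃ F : EuclideanSpace ℝ (Fin d) → EuclideanSpace ℝ (Fin d),
      (∀ x u, x - δ • f x = u ↔ x = F u) ∧
      ∀ u v, ‖F u - F v‖ ≤ (√(1 - 2 * K₃ * δ))⁻¹ * ‖u - v‖ := by
  have hK : 0 ≤ -K₃ * δ := mul_nonneg (by linarith) hδ
  have hsurj : Function.Surjective fun x => x - δ • f x :=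
    surjective_of_stronglyMonotone (c := 1 - K₃ * δ) (by fun_prop) (by linarith)
      (mul_norm_sub_sq_le_inner_implicit hδ hf)
  have hq : 0 < 1 - 2 * K₃ * δ := by linarith
  have hexp := mul_norm_sub_sq_le_implicit hδ hf
  have hright := Function.surjInv_eq hsurj
  refine ⟨Function.surjInv hsurj, fun x u => ⟨fun h => ?_, fun h => h ▸ hright u⟩, fun u v => ?_⟩
  · have h1 := hexp x (Function.surjInv hsurj u)
    rw [hright u, h, sub_self, norm_zero] at h1
    have h2 : ‖x - Function.surjInv hsurj u‖ ^ 2 ≤ 0 :=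
      nonpos_of_mul_nonpos_right (by simpa using h1) hq
    exact sub_eq_zero.1 (norm_eq_zero.1 (pow_eq_zero_iff two_ne_zero |>.1
      (le_antisymm h2 (sq_nonneg _))))
  · have h1 := hexp (Function.surjInv hsurj u) (Function.surjInv hsurj v)
    rw [hright u, hright v] at h1
    rw [le_inv_mul_iff₀ (Real.sqrt_pos.2 hq)]
    refine le_of_sq_le_sq ?_ (norm_nonneg _)
    rw [mul_pow, Real.sq_sqrt hq.le]
    exact h1

lemma continuous_coord_of_sum_sq_le
    (hg : ∀ x y, ∑ i, ∑ j, (g x i j - g y i j) ^ 2 ≤ K₄ * ‖x - y‖ ^ 2) (i : Fin d) (j : Fin m) :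
    Continuous fun x => g x i j := by
  refine (LipschitzWith.of_dist_le_mul (K := (√K₄).toNNReal) fun x y => ?_).continuous
  rw [Real.coe_toNNReal _ (Real.sqrt_nonneg _), Real.dist_eq, dist_eq_norm]
  have h1 : (g x i j - g y i j) ^ 2 ≤ K₄ * ‖x - y‖ ^ 2 :=
    ((Finset.single_le_sum (f := fun j => (g x i j - g y i j) ^ 2) (fun _ _ => sq_nonneg _)
      (Finset.mem_univ j)).trans
      (Finset.single_le_sum (f := fun i => ∑ j, (g x i j - g y i j) ^ 2)
        (fun _ _ => Finset.sum_nonneg fun _ _ => sq_nonneg _) (Finset.mem_univ i))).trans (hg x y)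
  calc |g x i j - g y i j| = √((g x i j - g y i j) ^ 2) := (Real.sqrt_sq_eq_abs _).symm
    _ ≤ √(K₄ * ‖x - y‖ ^ 2) := Real.sqrt_le_sqrt h1
    _ = √K₄ * ‖x - y‖ := by rw [Real.sqrt_mul' _ (sq_nonneg _), Real.sqrt_sq (norm_nonneg _)]

/-- One step `(x, (b, l)) ↦ F (x + g(x) b + l)` of the semi-implicit method, where `F` inverts
the implicit part. -/
noncomputable def implicitStep (F : EuclideanSpace ℝ (Fin d) → EuclideanSpace ℝ (Fin d))
    (g : EuclideanSpace ℝ (Fin d) → Matrix (Fin d) (Fin m) ℝ)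
    (p : EuclideanSpace ℝ (Fin d) × (EuclideanSpace ℝ (Fin m) × EuclideanSpace ℝ (Fin d))) :
    EuclideanSpace ℝ (Fin d) :=
  F (p.1 + (g p.1).toEuclideanLin p.2.1 + p.2.2)

lemma measurable_implicitStep {F : EuclideanSpace ℝ (Fin d) → EuclideanSpace ℝ (Fin d)}
    (hF : Continuous F)
    (hg : ∀ x y, ∑ i, ∑ j, (g x i j - g y i j) ^ 2 ≤ K₄ * ‖x - y‖ ^ 2) :
    Measurable (implicitStep F g) := by
  have hcg := continuous_coord_of_sum_sq_le hg
  have h : Continuous fun p : EuclideanSpace ℝ (Fin d) ×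
      (EuclideanSpace ℝ (Fin m) × EuclideanSpace ℝ (Fin d)) => (g p.1).toEuclideanLin p.2.1 := by
    have hc : Continuous fun (p : EuclideanSpace ℝ (Fin d) ×
        (EuclideanSpace ℝ (Fin m) × EuclideanSpace ℝ (Fin d))) (i : Fin d) =>
        ∑ j, g p.1 i j * p.2.1 j :=
      continuous_pi fun i => continuous_finsetSum _ fun j _ =>
        ((hcg i j).comp continuous_fst).mul (by fun_prop)
    refine ((PiLp.continuous_toLp 2 _).comp hc).congr fun p => ?_
    ext i
    exact (toEuclideanLin_apply_coord _ _ _).symm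
  exact (hF.comp ((continuous_fst.add h).add (by fun_prop))).measurable

end ImplicitStep

/-! ### From mean contraction of a random map to its kernel -/

section RandomMapContraction

variable {E W Ω : Type*} [NormedAddCommGroup E] [MeasurableSpace E] [BorelSpace E]
  [SecondCountableTopology E] [MeasurableSpace W] {mΩ : MeasurableSpace Ω} {P : Measure Ω}
  [IsProbabilityMeasure P] {Φ : E × W → E} {ξ : Ω → W} {r : ℝ≥0}

omit [NormedAddCommGroup E] [BorelSpace E] [SecondCountableTopology E] in
lemma randomMapKernel_map_apply (hΦ : Measurable Φ) (hξ : Measurable ξ) (x : E) :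
    randomMapKernel Φ (P.map ξ) x = P.map (fun ω => Φ (x, ξ ω)) := by
  have := Measure.isProbabilityMeasure_map (μ := P) hξ.aemeasurable
  rw [randomMapKernel_apply hΦ]
  exact Measure.map_map (hΦ.comp measurable_prodMk_left) hξ

omit [SecondCountableTopology E] in
/-- A random map that contracts in mean has a kernel contracting bounded Lipschitz functions. -/
lemma contractsLipschitz_randomMapKernel (hΦ : Measurable Φ) (hξ : Measurable ξ)
    (hint : ∀ x y, Integrable (fun ω => ‖Φ (x, ξ ω) - Φ (y, ξ ω)‖) P)
    (hr : ∀ x y, ∫ ω, ‖Φ (x, ξ ω) - Φ (y, ξ ω)‖ ∂P ≤ r * ‖x - y‖) :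
    ContractsLipschitz (randomMapKernel Φ (P.map ξ)) r := by
  have := Measure.isProbabilityMeasure_map (μ := P) hξ.aemeasurable
  intro h C K hC hK
  have hm : ∀ x, Measurable fun ω => Φ (x, ξ ω) := fun x => hΦ.comp (measurable_const.prodMk hξ)
  have hT : ∀ x, transitionOperator (randomMapKernel Φ (P.map ξ)) h x
      = ∫ ω, h (Φ (x, ξ ω)) ∂P := fun x => by
    rw [transitionOperator, randomMapKernel_map_apply hΦ hξ]
    exact integral_map (hm x).aemeasurable hK.continuous.measurable.aestronglyMeasurable
  have hi : ∀ x, Integrable (fun ω => h (Φ (x, ξ ω))) P := fun x =>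
    .of_bound (hK.continuous.measurable.comp (hm x)).aestronglyMeasurable C
      (ae_of_all _ fun ω => hC _)
  refine LipschitzWith.of_dist_le_mul fun x y => ?_
  rw [hT, hT, dist_eq_norm, ← integral_sub (hi x) (hi y), dist_eq_norm]
  calc ‖∫ ω, (h (Φ (x, ξ ω)) - h (Φ (y, ξ ω))) ∂P‖
      ≤ ∫ ω, K * ‖Φ (x, ξ ω) - Φ (y, ξ ω)‖ ∂P :=
        norm_integral_le_of_norm_le ((hint x y).const_mul _) (ae_of_all _ fun ω => by
          simpa only [dist_eq_norm] using hK.dist_le_mul (Φ (x, ξ ω)) (Φ (y, ξ ω)))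
    _ = K * ∫ ω, ‖Φ (x, ξ ω) - Φ (y, ξ ω)‖ ∂P := integral_const_mul _ _
    _ ≤ K * (r * ‖x - y‖) := mul_le_mul_of_nonneg_left (hr x y) K.2
    _ = ((r * K : ℝ≥0) : ℝ) * ‖x - y‖ := by push_cast; ring

/-- Coupling with the start `0` through the same noise turns the contraction into a drift condition.
-/
lemma lintegral_enorm_randomMapKernel_le (hΦ : Measurable Φ) (hξ : Measurable ξ)
    (hint : ∀ x y, Integrable (fun ω => ‖Φ (x, ξ ω) - Φ (y, ξ ω)‖) P)
    (hr : ∀ x y, ∫ ω, ‖Φ (x, ξ ω) - Φ (y, ξ ω)‖ ∂P ≤ r * ‖x - y‖) (x : E) :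
    ∫⁻ y, ‖y‖ₑ ∂(randomMapKernel Φ (P.map ξ) x)
      ≤ r * ‖x‖ₑ + ∫⁻ ω, ‖Φ (0, ξ ω)‖ₑ ∂P := by
  have := Measure.isProbabilityMeasure_map (μ := P) hξ.aemeasurable
  have hm : ∀ x, Measurable fun ω => Φ (x, ξ ω) := fun x => hΦ.comp (measurable_const.prodMk hξ)
  rw [randomMapKernel_map_apply hΦ hξ, lintegral_map (by fun_prop) (hm x)]
  have h1 : ∫⁻ ω, ‖Φ (x, ξ ω) - Φ (0, ξ ω)‖ₑ ∂P ≤ r * ‖x‖ₑ := by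
    have h2 := ofReal_integral_eq_lintegral_ofReal (hint x 0) (ae_of_all _ fun ω => norm_nonneg _)
    simp only [ofReal_norm] at h2
    rw [← h2]
    refine (ENNReal.ofReal_le_ofReal (hr x 0)).trans (le_of_eq ?_)
    rw [sub_zero, ENNReal.ofReal_mul r.coe_nonneg, ofReal_norm, ENNReal.ofReal_coe_nnreal]
  calc ∫⁻ ω, ‖Φ (x, ξ ω)‖ₑ ∂P
      ≤ ∫⁻ ω, (‖Φ (x, ξ ω) - Φ (0, ξ ω)‖ₑ + ‖Φ (0, ξ ω)‖ₑ) ∂P := lintegral_mono fun ω => by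
        simpa using enorm_add_le (Φ (x, ξ ω) - Φ (0, ξ ω)) (Φ (0, ξ ω))
    _ = ∫⁻ ω, ‖Φ (x, ξ ω) - Φ (0, ξ ω)‖ₑ ∂P + ∫⁻ ω, ‖Φ (0, ξ ω)‖ₑ ∂P :=
        lintegral_add_right _ (hm 0).enorm
    _ ≤ _ := by gcongr

omit [NormedAddCommGroup E] [BorelSpace E] [SecondCountableTopology E] in
-- Averaging the `n`-step laws over the starting point gives the law started from `π`. The induction
-- varies `φ`, absorbing the last step into the test function.
lemma lintegral_lintegral_iterate_comp (κ : Kernel E E) (π : Measure E) {φ : E → ℝ≥0∞}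
    (hφ : Measurable φ) (n : ℕ) :
    ∫⁻ x, ∫⁻ y, φ y ∂((fun ρ : Measure E => κ ∘ₘ ρ)^[n] (Measure.dirac x)) ∂π
      = ∫⁻ y, φ y ∂((fun ρ : Measure E => κ ∘ₘ ρ)^[n] π) := by
  induction n generalizing φ with
  | zero => simp [lintegral_dirac' _ hφ]
  | succ n ih =>
    simp only [Function.iterate_succ_apply']
    rw [Measure.lintegral_bind κ.measurable.aemeasurable hφ.aemeasurable]
    simp only [Measure.lintegral_bind κ.measurable.aemeasurable hφ.aemeasurable]
    exact ih hφ.lintegral_kernel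

end RandomMapContraction

/-! ### The semi-implicit Euler–Maruyama chain -/

section SemiImplicit

variable {Ω : Type*} [mΩ : MeasurableSpace Ω] {P : Measure Ω} {d m : ℕ}
  {B : ℝ≥0 → Ω → EuclideanSpace ℝ (Fin m)} {L : ℝ≥0 → Ω → EuclideanSpace ℝ (Fin d)}
  {f F : EuclideanSpace ℝ (Fin d) → EuclideanSpace ℝ (Fin d)}
  {g : EuclideanSpace ℝ (Fin d) → Matrix (Fin d) (Fin m) ℝ} {δ : ℝ≥0}

/-- The semi-implicit Euler–Maruyama solutions are exactly the versions of the chain obtained by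
iterating the explicit random map. -/
lemma isSemiImplicitEM_iff (hF : ∀ x u, x - (δ : ℝ) • f x = u ↔ x = F u)
    (x : EuclideanSpace ℝ (Fin d)) (X : ℕ → Ω → EuclideanSpace ℝ (Fin d)) :
    IsSemiImplicitEM P f g B L δ x X ↔ (∀ i, Measurable (X i)) ∧
      ∀ᵐ ω ∂P, ∀ i, X i ω = randomMapChain (implicitStep F g) (gridNoise B L δ) x i ω := by
  have hstep : ∀ a u b l : EuclideanSpace ℝ (Fin d),
      a = u + (δ : ℝ) • f a + b + l ↔ a = F (u + b + l) := fun a u b l => by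
    rw [← hF, sub_eq_iff_eq_add]
    have : u + (δ : ℝ) • f a + b + l = u + b + l + (δ : ℝ) • f a := by abel
    rw [this]
  refine and_congr_right fun _ => eventually_congr (ae_of_all _ fun ω => ?_)
  simp only [hstep]
  constructor
  · rintro ⟨h0, h⟩ i
    induction i with
    | zero => exact h0
    | succ i ih =>
      rw [h i, ih]
      rfl
  · intro h
    refine ⟨h 0, fun i => ?_⟩
    rw [h (i + 1), h i]
    rfl

variable [IsProbabilityMeasure P] {K₃ K₄ : ℝ}

lemma integrable_norm_implicitStep_sub (hB : IsBrownianVector P B) (hL : IsLevyProcess P L)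
    (hFc : Continuous F) {q : ℝ} (hq : 0 < q)
    (hFlip : ∀ u v, ‖F u - F v‖ ≤ (√q)⁻¹ * ‖u - v‖)
    (hg : ∀ x y, ∑ i, ∑ j, (g x i j - g y i j) ^ 2 ≤ K₄ * ‖x - y‖ ^ 2)
    (x y : EuclideanSpace ℝ (Fin d)) :
    Integrable (fun ω => ‖implicitStep F g (x, gridNoise B L δ 0 ω)
        - implicitStep F g (y, gridNoise B L δ 0 ω)‖) P ∧
      ∫ ω, ‖implicitStep F g (x, gridNoise B L δ 0 ω)
        - implicitStep F g (y, gridNoise B L δ 0 ω)‖ ∂P ≤ √((1 + K₄ * δ) / q) * ‖x - y‖ := by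
  have hΦ := measurable_implicitStep hFc hg
  have hξ := measurable_gridNoise hB hL δ 0
  set Y : Ω → EuclideanSpace ℝ (Fin d) := fun ω =>
    (x - y) + (g x - g y).toEuclideanLin (gridIncrement B δ 0 ω) with hY
  obtain ⟨hmem, hsq⟩ := memLp_and_integral_norm_sq_affine (hB.measurable_gridIncrement δ 0)
    (hB.hasLaw_gridIncrement_coord δ 0) (hB.iIndepFun_gridIncrement_coord δ 0) (x - y) (g x - g y)
  -- Both points receive the same noise, so the Lévy increment cancels and only the Gaussian part
  -- `Y` remains.
  have hbound : ∀ ω, ‖implicitStep F g (x, gridNoise B L δ 0 ω)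
      - implicitStep F g (y, gridNoise B L δ 0 ω)‖ ≤ (√q)⁻¹ * ‖Y ω‖ := fun ω => by
    refine (hFlip _ _).trans (le_of_eq ?_)
    congr 2
    simp only [hY, gridNoise, map_sub, LinearMap.sub_apply]
    abel
  have hYi : Integrable (fun ω => ‖Y ω‖) P := hmem.norm.integrable (by norm_num)
  have hint : Integrable (fun ω => ‖implicitStep F g (x, gridNoise B L δ 0 ω)
      - implicitStep F g (y, gridNoise B L δ 0 ω)‖) P := by
    refine (hYi.const_mul (√q)⁻¹).mono' ?_ (ae_of_all _ fun ω => ?_)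
    · exact ((hΦ.comp (measurable_const.prodMk hξ)).sub
        (hΦ.comp (measurable_const.prodMk hξ))).norm.aestronglyMeasurable
    · rw [norm_norm]
      exact hbound ω
  refine ⟨hint, ?_⟩
  calc ∫ ω, ‖implicitStep F g (x, gridNoise B L δ 0 ω)
        - implicitStep F g (y, gridNoise B L δ 0 ω)‖ ∂P
      ≤ ∫ ω, (√q)⁻¹ * ‖Y ω‖ ∂P := integral_mono hint (hYi.const_mul _) hbound
    _ = (√q)⁻¹ * ∫ ω, ‖Y ω‖ ∂P := integral_const_mul _ _
    _ ≤ (√q)⁻¹ * √((1 + K₄ * δ) * ‖x - y‖ ^ 2) := by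
        refine mul_le_mul_of_nonneg_left ((integral_norm_le_sqrt hmem).trans
          (Real.sqrt_le_sqrt ?_)) (by positivity)
        rw [hsq]
        have := mul_le_mul_of_nonneg_left (hg x y) δ.2
        simp only [Matrix.sub_apply]
        change _ + (δ : ℝ) * _ ≤ _
        change (δ : ℝ) * _ ≤ (δ : ℝ) * _ at this
        linarith
    _ = √((1 + K₄ * δ) / q) * ‖x - y‖ := by
        rw [Real.sqrt_mul' _ (sq_nonneg _), Real.sqrt_sq (norm_nonneg _), Real.sqrt_div' _ hq.le]
        ring

/-- This makes the additive constant of the drift condition finite; integrability of the Lévy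
increment enters here. -/
lemma lintegral_enorm_implicitStep_zero_ne_top (hB : IsBrownianVector P B)
    (hLint : ∀ t, Integrable (L t) P) {k : ℝ} (hk : 0 ≤ k)
    (hFlip : ∀ u v, ‖F u - F v‖ ≤ k * ‖u - v‖) :
    ∫⁻ ω, ‖implicitStep F g (0, gridNoise B L δ 0 ω)‖ₑ ∂P ≠ ∞ := by
  obtain ⟨hmem, -⟩ := memLp_and_integral_norm_sq_affine (hB.measurable_gridIncrement δ 0)
    (hB.hasLaw_gridIncrement_coord δ 0) (hB.iIndepFun_gridIncrement_coord δ 0)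
    (0 : EuclideanSpace ℝ (Fin d)) (g 0)
  have hYi := hmem.integrable (by norm_num)
  have hl : Integrable (gridIncrement L δ 0) P := (hLint _).sub (hLint _)
  have hFc : Continuous F := (LipschitzWith.of_dist_le_mul (K := ⟨k, hk⟩) fun u v => by
    rw [dist_eq_norm, dist_eq_norm]
    exact hFlip u v).continuous
  have hmeas : AEStronglyMeasurable
      (fun ω => implicitStep F g (0, gridNoise B L δ 0 ω)) P :=
    hFc.comp_aestronglyMeasurable (hYi.add hl).aestronglyMeasurable
  have hint : Integrable (fun ω => implicitStep F g (0, gridNoise B L δ 0 ω)) P := by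
    refine (((hYi.add hl).norm.const_mul k).add (integrable_const ‖F 0‖)).mono' hmeas
      (ae_of_all _ fun ω => ?_)
    have h1 := hFlip (0 + (g 0).toEuclideanLin (gridIncrement B δ 0 ω) + gridIncrement L δ 0 ω) 0
    rw [sub_zero] at h1
    have h2 := norm_add_le
      (F (0 + (g 0).toEuclideanLin (gridIncrement B δ 0 ω) + gridIncrement L δ 0 ω) - F 0) (F 0)
    rw [sub_add_cancel] at h2
    exact h2.trans (by simpa using h1)
  exact hint.hasFiniteIntegral.ne

lemma transitionProb_eq (hB : IsBrownianVector P B) (hL : IsLevyProcess P L)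
    (hBL : IndepFun (fun ω t => B t ω) (fun ω t => L t ω) P)
    (hΦ : Measurable (implicitStep F g)) (hF : ∀ x u, x - (δ : ℝ) • f x = u ↔ x = F u)
    {X : EuclideanSpace ℝ (Fin d) → ℕ → Ω → EuclideanSpace ℝ (Fin d)}
    (hX : ∀ x, IsSemiImplicitEM P f g B L δ x (X x)) (i : ℕ) (x : EuclideanSpace ℝ (Fin d))
    {S : Set (EuclideanSpace ℝ (Fin d))} (hS : MeasurableSet S) :
    transitionProb P X i x S
      = (fun ρ : Measure (EuclideanSpace ℝ (Fin d)) =>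
          randomMapKernel (implicitStep F g) (P.map (gridNoise B L δ 0)) ∘ₘ ρ)^[i]
        (Measure.dirac x) S := by
  have := Measure.isProbabilityMeasure_map (μ := P) (measurable_gridNoise hB hL δ 0).aemeasurable
  obtain ⟨hm, h⟩ := (isSemiImplicitEM_iff hF x (X x)).1 (hX x)
  have heq : X x i =ᵐ[P] randomMapChain (implicitStep F g) (gridNoise B L δ) x i := by
    filter_upwards [h] with ω hω using hω i
  -- Time `n` sees exactly the increments with index below `n`, so the `n`-th increment is
  -- independent of it.
  rw [← map_randomMapChain hΦ (F := fun n => noiseAlgebra B L δ (Set.Iio n))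
    (fun a b hab => noiseAlgebra_mono δ (Set.Iio_subset_Iio hab))
    (fun n => sup_le (brownianIncrementAlgebra_le hB.measurable δ _)
      (levyIncrementAlgebra_le hL.measurable δ _))
    (fun n => measurable_gridNoise_noiseAlgebra δ (Set.mem_Iio.2 n.lt_succ_self))
    (fun n => indep_of_indep_of_le_right
      (indep_noiseAlgebra hB hL hBL δ (T := {n}) (by simp))
      (measurable_gridNoise_noiseAlgebra δ (Set.mem_singleton n)).comap_le)
    (fun n => map_gridNoise hB hL hBL δ n) x i, ← Measure.map_congr heq,
    Measure.map_apply (hm i) hS]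
  rfl

/-- Invariance for one step gives invariance for all, since the `i`-step law is an iterate of a
single kernel; conversely take `i = 1`. -/
lemma isInvariantMeasure_iff (hB : IsBrownianVector P B) (hL : IsLevyProcess P L)
    (hBL : IndepFun (fun ω t => B t ω) (fun ω t => L t ω) P)
    (hΦ : Measurable (implicitStep F g)) (hF : ∀ x u, x - (δ : ℝ) • f x = u ↔ x = F u)
    {X : EuclideanSpace ℝ (Fin d) → ℕ → Ω → EuclideanSpace ℝ (Fin d)}
    (hX : ∀ x, IsSemiImplicitEM P f g B L δ x (X x)) (π : Measure (EuclideanSpace ℝ (Fin d))) :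
    IsInvariantMeasure P X π ↔ IsProbabilityMeasure π ∧
      randomMapKernel (implicitStep F g) (P.map (gridNoise B L δ 0)) ∘ₘ π = π := by
  set κ := randomMapKernel (implicitStep F g) (P.map (gridNoise B L δ 0))
  have key : ∀ (i : ℕ) (S : Set (EuclideanSpace ℝ (Fin d))), MeasurableSet S →
      ∫⁻ x, transitionProb P X i x S ∂π
        = (fun ρ : Measure (EuclideanSpace ℝ (Fin d)) => κ ∘ₘ ρ)^[i] π S := fun i S hS => by
    have h := lintegral_lintegral_iterate_comp κ π (measurable_one.indicator hS) i
    simp only [lintegral_indicator_one hS] at h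
    rw [← h]
    exact lintegral_congr fun x => transitionProb_eq hB hL hBL hΦ hF hX i x hS
  refine and_congr_right fun _ => ⟨fun h => ?_, fun h i S hS => ?_⟩
  · ext S hS
    rw [h 1 S hS, key 1 S hS]
    rfl
  · rw [key i S hS, Function.iterate_fixed h]

end SemiImplicit

theorem theorem4p3 {Ω : Type*} [MeasurableSpace Ω] (P : Measure Ω) [IsProbabilityMeasure P]
    (d m : ℕ)
    -- the driving Brownian motion and the independent Lévy process with triplet `(0, 0, ν)`
    (B : ℝ≥0 → Ω → EuclideanSpace ℝ (Fin m)) (hB : IsBrownianVector P B)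
    (L : ℝ≥0 → Ω → EuclideanSpace ℝ (Fin d)) (hL : IsLevyProcess P L)
    (hBL : IndepFun (fun ω t => B t ω) (fun ω t => L t ω) P)
    (ν : Measure (EuclideanSpace ℝ (Fin d))) (hLν : HasPureJumpTriplet P L ν)
    (γ₀ γinf : ℝ) (hγ₀ : γ₀ ∈ Set.Icc (1 : ℝ) 2) (hγinf : 1 < γinf)
    (hν₀ : ∫⁻ z in {z | ‖z‖ < 1}, ENNReal.ofReal (‖z‖ ^ γ₀) ∂ν < ∞)
    (hνinf : ∫⁻ z in {z | 1 ≤ ‖z‖}, ENNReal.ofReal (‖z‖ ^ γinf) ∂ν < ∞)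
    (hLmean : ∀ t, Integrable (L t) P ∧ ∫ ω, L t ω ∂P = 0)
    -- the coefficients
    (f : EuclideanSpace ℝ (Fin d) → EuclideanSpace ℝ (Fin d)) (hf : Continuous f)
    (g : EuclideanSpace ℝ (Fin d) → Matrix (Fin d) (Fin m) ℝ)
    (K₃ K₄ : ℝ) (hK₃ : K₃ < -1 / 2) (hK₄ : 0 < K₄) (hK : K₄ + 2 * K₃ < -1)
    (hf_one_sided : ∀ x y, inner ℝ (x - y) (f x - f y) ≤ K₃ * ‖x - y‖ ^ 2)
    (hg_lip : ∀ x y, ∑ i, ∑ j, (g x i j - g y i j) ^ 2 ≤ K₄ * ‖x - y‖ ^ 2)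
    -- the step size
    (Δt : ℝ≥0) (hΔt_pos : 0 < Δt) (hΔt_lt : Δt < 1) :
    -- the numerical solution exists and is almost surely unique for each starting point
    (∀ x, (∃ X, IsSemiImplicitEM P f g B L Δt x X) ∧
      ∀ X X', IsSemiImplicitEM P f g B L Δt x X → IsSemiImplicitEM P f g B L Δt x X' →
        ∀ᵐ ω ∂P, ∀ i, X i ω = X' i ω) ∧
    -- it has exactly one invariant measure
    ∀ X : EuclideanSpace ℝ (Fin d) → ℕ → Ω → EuclideanSpace ℝ (Fin d),
      (∀ x, IsSemiImplicitEM P f g B L Δt x (X x)) →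
        ∃! π : Measure (EuclideanSpace ℝ (Fin d)), IsInvariantMeasure P X π := by
  have hδ : (0 : ℝ) < Δt := by exact_mod_cast hΔt_pos
  obtain ⟨F, hF, hFlip⟩ := exists_implicit_inverse hf hδ.le (by linarith) hf_one_sided
  have hq : 0 < 1 - 2 * K₃ * Δt := by nlinarith
  have hFc : Continuous F := (LipschitzWith.of_dist_le_mul
    (K := ⟨(√(1 - 2 * K₃ * Δt))⁻¹, by positivity⟩) fun u v => by
      rw [dist_eq_norm, dist_eq_norm]
      exact hFlip u v).continuous
  have hΦ := measurable_implicitStep hFc hg_lip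
  have hξ := measurable_gridNoise hB hL Δt
  constructor
  · intro x
    refine ⟨⟨randomMapChain (implicitStep F g) (gridNoise B L Δt) x,
      (isSemiImplicitEM_iff hF x _).2 ⟨fun i => ?_, ae_of_all _ fun _ _ => rfl⟩⟩, ?_⟩
    · exact measurable_randomMapChain (F := fun _ => inferInstance) hΦ monotone_const hξ x i
    · intro X X' hX hX'
      filter_upwards [((isSemiImplicitEM_iff hF x X).1 hX).2,
        ((isSemiImplicitEM_iff hF x X').1 hX').2] with ω h h' i
      rw [h i, h' i]
  · intro X hX
    simp only [isInvariantMeasure_iff hB hL hBL hΦ hF hX]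
    have := Measure.isProbabilityMeasure_map (μ := P) (hξ 0).aemeasurable
    have := isMarkovKernel_randomMapKernel (μ := P.map (gridNoise B L Δt 0)) hΦ
    have hcontr := integrable_norm_implicitStep_sub (δ := Δt) hB hL hFc hq hFlip hg_lip
    let r : ℝ≥0 := ⟨√((1 + K₄ * Δt) / (1 - 2 * K₃ * Δt)), Real.sqrt_nonneg _⟩
    -- Equivalent to `(K₄ + 2K₃) Δt < 0`.
    have hr : r < 1 := by
      rw [← NNReal.coe_lt_coe]
      change √((1 + K₄ * Δt) / (1 - 2 * K₃ * Δt)) < 1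
      rw [Real.sqrt_lt' one_pos, one_pow, div_lt_one hq]
      nlinarith
    exact (contractsLipschitz_randomMapKernel (r := r) hΦ (hξ 0) (fun x y => (hcontr x y).1)
      (fun x y => (hcontr x y).2)).existsUnique_comp_eq hr
      (lintegral_enorm_implicitStep_zero_ne_top (g := g) hB (fun t => (hLmean t).1)
        (by positivity) hFlip)
      (lintegral_enorm_randomMapKernel_le (r := r) hΦ (hξ 0) (fun x y => (hcontr x y).1)
        (fun x y => (hcontr x y).2))
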